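/- Let $n\ge 3$ and $\alpha\ge 1$, and let $X_1,\dots,X_n$ be independent gamma$(\alpha,1)$ random variables, i.e. with common density $x^{\alpha-1}e^{-x}/\Gamma(\alpha)$ on $(0,\infty)$. For a weight vector $\theta=(\theta_1,\dots,\theta_n)$ with nonnegative components, let $F_\theta$ be the distribution function of $\sum_{i=1}^n\theta_iX_i$. Let $\eta,\theta\in[0,\infty)^n$ be such that $\theta$ majorizes $\eta$ ($\eta\prec\theta$: $\sum_{i=1}^n\eta_i=\sum_{i=1}^n\theta_i$, and for each $k\le n$ the sum of the $k$ largest components of $\eta$ is at most the sum of the $k$ largest components of $\theta$), $\theta$ is not a permutation of $\eta$, and $\eta_i\ne\theta_i$ for at most three indices $i$. Then $F_\eta(x)-F_\theta(x)$ changes signs exactly once, from $-$ to $+$, as $x$ increases from $0$ to $\infty$; that is, there is $x_0\in(0,\infty)$ such that $F_\eta(x)<F_\theta(x)$ for all $0<x<x_0$ and $F_\eta(x)>F_\theta(x)$ for all $x>x_0$. -/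

import Mathlib

open MeasureTheory ProbabilityTheory

namespace GammaConvolution

/-- The components of `x` in decreasing order: `decreasing x 0 ≥ decreasing x 1 ≥ …`. -/
noncomputable def decreasing {n : ℕ} (x : Fin n → ℝ) : Fin n → ℝ :=
  fun i => x (Tuple.sort x i.rev)

/-- `η ≺ θ` (`θ` majorizes `η`): for every `k`, the sum of the `k` largest components of `η` is at
most that of `θ`, and the total sums agree. -/
def Majorized {n : ℕ} (η θ : Fin n → ℝ) : Prop :=
  (∀ k : ℕ, k ≤ n →
    ∑ i : Fin n with i.val < k, decreasing η i ≤ ∑ i : Fin n with i.val < k, decreasing θ i) ∧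
  ∑ i, η i = ∑ i, θ i

/-- The distribution function `F_θ` of the weighted sum `∑ i, θ i * X i`. -/
noncomputable def weightedCDF {Ω : Type*} [MeasurableSpace Ω] (P : Measure Ω) {n : ℕ}
    (X : Fin n → Ω → ℝ) (θ : Fin n → ℝ) : ℝ → ℝ :=
  fun x => cdf (P.map (fun ω => ∑ i, θ i * X i ω)) x

/-- `D` changes signs exactly once on `(0, ∞)`, from `-` to `+`. -/
def ChangesSignOnceNegToPos (D : ℝ → ℝ) : Prop :=
  ∃ x₀ : ℝ, 0 < x₀ ∧ (∀ x, 0 < x → x < x₀ → D x < 0) ∧ (∀ x, x₀ < x → 0 < D x)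

end GammaConvolution

namespace GammaConvolution

open Set Filter Topology
open scoped Measure

/-! The difference D of the two distribution functions is studied through `UpCrossing`: D ≥ 0 at y
forces D > 0 at every x > y. Two facts carry this property.

First, for α ≥ 1 the gamma density is log-concave, so adding a common independent summand preserves
it (`UpCrossing.integral_comp_sub_mul`). Weights shared by η and θ can thus be ignored.

Second, it holds when two weights are spread apart, even if their sum changes
(`upCrossing_pair_of_lt`). Scaling turns the passage from y to x into an exponential tilt in u + v,
and the regions where D gains and loses mass lie on opposite sides of a line u + v = s.

For three weights, majorization raises the largest and lowers the smallest. At a fixed y with D y ≥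
0, the intermediate value theorem gives an intermediate triple, depending on y, whose distribution
function at y lies between the two given ones. Each half of the move spreads one pair, so both
inequalities propagate from y to x (`upCrossing_triple`).

Finally, equal means forbid D from having a strict constant sign on (0, ∞), so the crossing occurs
(`exists_gammaSumCDF_le`). -/

/-- The law of `∑ i, c i * X i` for independent gamma variables `X i` of shape `α`, where `c` runs
through the list of weights. -/
noncomputable def gammaSumLaw (α : ℝ) : List ℝ → Measure ℝ
  | [] => Measure.dirac 0
  | c :: l => ((gammaMeasure α 1).map (c * ·)) ∗ gammaSumLaw α l

/-- The distribution function of `gammaSumLaw`. -/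
noncomputable def gammaSumCDF (α : ℝ) (l : List ℝ) (y : ℝ) : ℝ :=
  (gammaSumLaw α l).real (Iic y)

/-! ### Laws of weighted gamma sums and integrals against the gamma law -/

section Basic

variable {α : ℝ}

lemma isProbabilityMeasure_gammaSumLaw (hα : 0 < α) (l : List ℝ) :
    IsProbabilityMeasure (gammaSumLaw α l) := by
  have := isProbabilityMeasure_gammaMeasure hα one_pos
  induction l with
  | nil => exact Measure.dirac.isProbabilityMeasure
  | cons c l ih =>
    have : IsProbabilityMeasure ((gammaMeasure α 1).map (c * ·)) :=
      Measure.isProbabilityMeasure_map (by fun_prop)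
    unfold gammaSumLaw
    infer_instance

lemma gammaSumLaw_perm (hα : 0 < α) {l l' : List ℝ} (h : l.Perm l') :
    gammaSumLaw α l = gammaSumLaw α l' := by
  have := isProbabilityMeasure_gammaMeasure hα one_pos
  induction h with
  | nil => rfl
  | cons c _ ih => simp only [gammaSumLaw, ih]
  | swap a b l =>
    have := isProbabilityMeasure_gammaSumLaw hα l
    simp only [gammaSumLaw]
    rw [← Measure.conv_assoc, ← Measure.conv_assoc,
      Measure.conv_comm ((gammaMeasure α 1).map (b * ·))]
  | trans _ _ h1 h2 => exact h1.trans h2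

lemma gammaSumCDF_perm (hα : 0 < α) {l l' : List ℝ} (h : l.Perm l') :
    gammaSumCDF α l = gammaSumCDF α l' := by
  ext y
  rw [gammaSumCDF, gammaSumCDF, gammaSumLaw_perm hα h]

lemma gammaSumCDF_nonneg (l : List ℝ) (y : ℝ) : 0 ≤ gammaSumCDF α l y := measureReal_nonneg

lemma gammaSumCDF_le_one (hα : 0 < α) (l : List ℝ) (y : ℝ) : gammaSumCDF α l y ≤ 1 := by
  have := isProbabilityMeasure_gammaSumLaw hα l
  exact measureReal_le_one

lemma abs_gammaSumCDF_le_one (hα : 0 < α) (l : List ℝ) (y : ℝ) : |gammaSumCDF α l y| ≤ 1 := by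
  rw [abs_of_nonneg (gammaSumCDF_nonneg l y)]
  exact gammaSumCDF_le_one hα l y

lemma gammaSumCDF_mono (hα : 0 < α) (l : List ℝ) : Monotone (gammaSumCDF α l) := by
  have := isProbabilityMeasure_gammaSumLaw hα l
  exact fun x y h => measureReal_mono (Iic_subset_Iic.2 h)

lemma measurable_gammaSumCDF (hα : 0 < α) (l : List ℝ) : Measurable (gammaSumCDF α l) :=
  (gammaSumCDF_mono hα l).measurable

lemma gammaSumCDF_nil (y : ℝ) : gammaSumCDF α [] y = if 0 ≤ y then 1 else 0 := by
  simp only [gammaSumCDF, gammaSumLaw, measureReal_def]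
  rw [Measure.dirac_apply' _ measurableSet_Iic]
  by_cases h : 0 ≤ y <;> simp [indicator, h]

lemma integrable_gammaSumCDF_sub_mul (hα : 0 < α) (l : List ℝ) (y c : ℝ) :
    Integrable (fun w => gammaSumCDF α l (y - c * w)) (gammaMeasure α 1) := by
  have := isProbabilityMeasure_gammaMeasure hα one_pos
  refine Integrable.of_bound (C := 1)
    ((measurable_gammaSumCDF hα l).comp (by fun_prop)).aestronglyMeasurable (ae_of_all _ fun w => ?_)
  exact abs_gammaSumCDF_le_one hα l _

lemma gammaSumCDF_cons (hα : 0 < α) (c : ℝ) (l : List ℝ) (y : ℝ) :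
    gammaSumCDF α (c :: l) y = ∫ w, gammaSumCDF α l (y - c * w) ∂(gammaMeasure α 1) := by
  have := isProbabilityMeasure_gammaMeasure hα one_pos
  have := isProbabilityMeasure_gammaSumLaw hα l
  have hp : IsProbabilityMeasure ((gammaMeasure α 1).map (c * ·)) :=
    Measure.isProbabilityMeasure_map (by fun_prop)
  have h : (gammaSumLaw α (c :: l)) (Iic y)
      = ∫⁻ w, (gammaSumLaw α l) (Iic (y - c * w)) ∂(gammaMeasure α 1) := by
    rw [gammaSumLaw, Measure.conv, Measure.map_apply (by fun_prop) measurableSet_Iic,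
      Measure.prod_apply (measurableSet_Iic.preimage (by fun_prop))]
    rw [lintegral_map (measurable_measure_prodMk_left (measurableSet_Iic.preimage (by fun_prop)))
      (by fun_prop)]
    refine lintegral_congr fun w => ?_
    congr 1
    ext z
    simp [le_sub_iff_add_le']
  rw [integral_eq_lintegral_of_nonneg_ae (ae_of_all _ fun w => gammaSumCDF_nonneg l _)
    (integrable_gammaSumCDF_sub_mul hα l y c).aestronglyMeasurable, gammaSumCDF, measureReal_def, h]
  congr 1
  refine lintegral_congr fun w => ?_
  simp [gammaSumCDF]

lemma ae_pos_gammaMeasure : ∀ᵐ w ∂(gammaMeasure α 1), 0 < w := by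
  have h : gammaMeasure α 1 (Iic 0) = 0 := by
    rw [gammaMeasure, withDensity_apply _ measurableSet_Iic, setLIntegral_congr Iio_ae_eq_Iic.symm,
      lintegral_gammaPDF_of_nonpos le_rfl]
  rw [ae_iff]
  convert h using 2
  ext w
  simp

lemma gammaSumCDF_of_neg (hα : 0 < α) {l : List ℝ} (hl : ∀ c ∈ l, 0 ≤ c) {y : ℝ} (hy : y < 0) :
    gammaSumCDF α l y = 0 := by
  induction l generalizing y with
  | nil => simp [gammaSumCDF_nil, hy]
  | cons c l ih =>
    rw [gammaSumCDF_cons hα]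
    refine integral_eq_zero_of_ae ?_
    filter_upwards [ae_pos_gammaMeasure (α := α)] with w hw
    refine ih (fun c' hc' => hl c' (by simp [hc'])) ?_
    have := mul_nonneg (hl c (by simp)) hw.le
    linarith

/-- The distribution function decreases in each weight. -/
lemma gammaSumCDF_cons_anti (hα : 0 < α) {c c' : ℝ} (h : c ≤ c') (l : List ℝ) (y : ℝ) :
    gammaSumCDF α (c' :: l) y ≤ gammaSumCDF α (c :: l) y := by
  rw [gammaSumCDF_cons hα, gammaSumCDF_cons hα]
  refine integral_mono_ae (integrable_gammaSumCDF_sub_mul hα l y c')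
    (integrable_gammaSumCDF_sub_mul hα l y c) ?_
  filter_upwards [ae_pos_gammaMeasure (α := α)] with w hw
  exact gammaSumCDF_mono hα l (by nlinarith)

lemma gammaMeasure_absolutelyContinuous : gammaMeasure α 1 ≪ volume :=
  withDensity_absolutelyContinuous _ _

lemma gammaMeasure_singleton (w : ℝ) : gammaMeasure α 1 {w} = 0 :=
  gammaMeasure_absolutelyContinuous (by simp)

lemma integral_gammaMeasure (hα : 0 < α) (f : ℝ → ℝ) :
    ∫ w, f w ∂(gammaMeasure α 1)
      = (Real.Gamma α)⁻¹ * ∫ w in Ioi 0, w ^ (α - 1) * Real.exp (-w) * f w := by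
  have hm : Measurable (gammaPDF α 1) := (measurable_gammaPDFReal α 1).ennreal_ofReal
  rw [gammaMeasure, integral_withDensity_eq_integral_toReal_smul hm
    (ae_of_all _ fun w => ENNReal.ofReal_lt_top), ← integral_indicator measurableSet_Ioi,
    ← integral_const_mul]
  have h0 : ∀ᵐ w : ℝ, w ≠ 0 := by simp [ae_iff]
  refine integral_congr_ae ?_
  filter_upwards [h0] with w hw
  have hG := Real.Gamma_pos_of_pos hα
  rcases lt_or_gt_of_ne hw with h | h
  · simp [gammaPDF_of_neg h, h.le]
  · simp only [gammaPDF, gammaPDFReal_nonneg hα one_pos, ENNReal.toReal_ofReal, smul_eq_mul,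
      mem_Ioi, h, indicator_of_mem]
    simp only [gammaPDFReal, h.le, if_true, Real.one_rpow, one_mul, one_div]
    ring

lemma integrable_gammaMeasure_iff (hα : 0 < α) (f : ℝ → ℝ) :
    Integrable f (gammaMeasure α 1)
      ↔ IntegrableOn (fun w => w ^ (α - 1) * Real.exp (-w) * f w) (Ioi 0) := by
  have hm : Measurable (gammaPDF α 1) := (measurable_gammaPDFReal α 1).ennreal_ofReal
  have hG := Real.Gamma_pos_of_pos hα
  rw [gammaMeasure, integrable_withDensity_iff_integrable_smul' hm
    (ae_of_all _ fun w => ENNReal.ofReal_lt_top), ← integrable_indicator_iff measurableSet_Ioi,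
    ← integrable_const_mul_iff (c := (Real.Gamma α)⁻¹) (isUnit_iff_ne_zero.2 (by positivity))
      ((Ioi 0).indicator _)]
  have h0 : ∀ᵐ w : ℝ, w ≠ 0 := by simp [ae_iff]
  refine integrable_congr ?_
  filter_upwards [h0] with w hw
  rcases lt_or_gt_of_ne hw with h | h
  · simp [gammaPDF_of_neg h, h.le]
  · simp only [gammaPDF, gammaPDFReal_nonneg hα one_pos, ENNReal.toReal_ofReal, smul_eq_mul,
      mem_Ioi, h, indicator_of_mem]
    simp only [gammaPDFReal, h.le, if_true, Real.one_rpow, one_mul, one_div]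
    ring

/-- Rescaling a gamma variable tilts its law exponentially. -/
lemma integral_gammaMeasure_scale (hα : 0 < α) {r : ℝ} (hr : 0 < r) (f : ℝ → ℝ) :
    ∫ w, f w ∂(gammaMeasure α 1)
      = r ^ α * ∫ w, f (r * w) * Real.exp (-((r - 1) * w)) ∂(gammaMeasure α 1) := by
  rw [integral_gammaMeasure hα, integral_gammaMeasure hα,
    mul_left_comm]
  congr 1
  have h := integral_comp_mul_left_Ioi' (fun w => w ^ (α - 1) * Real.exp (-w) * f w) 0 hr
  rw [mul_zero] at h
  rw [← h, smul_eq_mul, ← integral_const_mul, ← integral_const_mul]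
  refine setIntegral_congr_fun measurableSet_Ioi fun w (hw : 0 < w) => ?_
  have h1 : Real.exp (-w) * Real.exp (-((r - 1) * w)) = Real.exp (-(r * w)) := by
    rw [← Real.exp_add]; ring_nf
  have h2 : r ^ α = r * r ^ (α - 1) := by
    rw [← Real.rpow_one_add' hr.le (by linarith)]; ring_nf
  rw [Real.mul_rpow hr.le hw.le, h2, ← h1]
  ring

lemma gammaMeasure_Ioo_pos (hα : 0 < α) {p q : ℝ} (hp : 0 ≤ p) (hpq : p < q) :
    0 < gammaMeasure α 1 (Ioo p q) := by
  rw [gammaMeasure, withDensity_apply _ measurableSet_Ioo]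
  rw [lintegral_pos_iff_support (show Measurable (gammaPDF α 1) from
    (measurable_gammaPDFReal α 1).ennreal_ofReal),
    Measure.restrict_apply' measurableSet_Ioo]
  have : Ioo p q ⊆ Function.support (gammaPDF α 1) ∩ Ioo p q := fun w hw =>
    ⟨(ENNReal.ofReal_pos.2 (gammaPDFReal_pos hα one_pos (hp.trans_lt hw.1))).ne', hw⟩
  refine lt_of_lt_of_le ?_ (measure_mono this)
  simp [hpq]

end Basic

/-! ### Upward crossings and their stability under gamma convolution -/

/-- Once `D` is nonnegative at a point of `(0, ∞)`, it is positive from there on. -/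
def UpCrossing (D : ℝ → ℝ) : Prop :=
  ∀ ⦃y x : ℝ⦄, 0 < y → y < x → 0 ≤ D y → 0 < D x

section Convolution

variable {α : ℝ}

lemma integrable_comp_sub_mul (hα : 0 < α) {d : ℝ → ℝ} (hdm : Measurable d) {B : ℝ}
    (hB : ∀ z, |d z| ≤ B) (y c : ℝ) :
    Integrable (fun w => d (y - c * w)) (gammaMeasure α 1) := by
  have := isProbabilityMeasure_gammaMeasure hα one_pos
  exact Integrable.of_bound (C := B) (hdm.comp (by fun_prop)).aestronglyMeasurable
    (ae_of_all _ fun w => hB _)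

/-- Otherwise d < 0 on all of (0, y), and the gamma law charges (0, y / c), which makes the integral
strictly negative. -/
lemma exists_nonneg_of_integral_nonneg (hα : 0 < α) {d : ℝ → ℝ} (hdm : Measurable d) {B : ℝ}
    (hB : ∀ z, |d z| ≤ B) (h0 : ∀ z < 0, d z = 0) {c y : ℝ} (hc : 0 < c) (hy : 0 < y)
    (hD : 0 ≤ ∫ w, d (y - c * w) ∂(gammaMeasure α 1)) :
    ∃ z, 0 < z ∧ z < y ∧ 0 ≤ d z := by
  by_contra! h
  have hne : ∀ᵐ w ∂(gammaMeasure α 1), w ≠ y / c := by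
    rw [ae_iff]; simpa using gammaMeasure_singleton (α := α) (y / c)
  have hnn : 0 ≤ᵐ[gammaMeasure α 1] fun w => -d (y - c * w) := by
    filter_upwards [hne, ae_pos_gammaMeasure (α := α)] with w hw hw0
    have hw' : y - c * w ≠ 0 := fun e => hw (by field_simp; linarith)
    have := mul_pos hc hw0
    rcases lt_or_gt_of_ne hw' with h1 | h1
    · simp [h0 _ h1]
    · simpa using (h _ h1 (by linarith)).le
  have hpos : 0 < ∫ w, -d (y - c * w) ∂(gammaMeasure α 1) := by
    rw [integral_pos_iff_support_of_nonneg_ae hnn (integrable_comp_sub_mul hα hdm hB y c).neg]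
    refine (gammaMeasure_Ioo_pos hα le_rfl (div_pos hy hc)).trans_le (measure_mono fun w hw => ?_)
    have h1 : w * c < y := (lt_div_iff₀ hc).1 hw.2
    have := mul_pos hc hw.1
    exact neg_ne_zero.2 (h _ (by linarith) (by linarith)).ne
  rw [integral_neg] at hpos
  linarith

/-- The threshold is the infimum of the points of (0, ∞) where d ≥ 0. It may be 0, and the sign of d
at the threshold itself is left open. -/
lemma UpCrossing.exists_threshold {d : ℝ → ℝ} (hd : UpCrossing d) {y z : ℝ} (hz : 0 < z)
    (hzy : z < y) (hdz : 0 ≤ d z) :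
    ∃ z₀, 0 ≤ z₀ ∧ z₀ < y ∧ (∀ t, 0 < t → t < z₀ → d t < 0) ∧ ∀ t, z₀ < t → 0 < d t := by
  have hbdd : BddBelow {t | 0 < t ∧ 0 ≤ d t} := ⟨0, fun t ht => ht.1.le⟩
  have hmem : z ∈ {t | 0 < t ∧ 0 ≤ d t} := ⟨hz, hdz⟩
  refine ⟨sInf {t | 0 < t ∧ 0 ≤ d t}, le_csInf ⟨z, hmem⟩ fun t ht => ht.1.le,
    (csInf_le hbdd hmem).trans_lt hzy, fun t ht htz => ?_, fun t ht => ?_⟩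
  · by_contra! hle
    exact absurd (csInf_le hbdd ⟨ht, hle⟩) htz.not_ge
  · obtain ⟨s, hs, hst⟩ := exists_lt_of_csInf_lt ⟨z, hmem⟩ ht
    exact hd hs.1 hst hs.2

/-- Total positivity of the gamma density with `1 ≤ α`: adding an independent multiple of a gamma
variable preserves `UpCrossing`. -/
lemma UpCrossing.integral_comp_sub_mul (hα : 1 ≤ α) {d : ℝ → ℝ} (hdm : Measurable d) {B : ℝ}
    (hB : ∀ z, |d z| ≤ B) (h0 : ∀ z < 0, d z = 0) (hd : UpCrossing d) {c : ℝ} (hc : 0 < c) :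
    UpCrossing fun y => ∫ w, d (y - c * w) ∂(gammaMeasure α 1) := by
  intro y x hy hyx hD
  have hα0 : 0 < α := by linarith
  obtain ⟨z, hz, hzy, hdz⟩ := exists_nonneg_of_integral_nonneg hα0 hdm hB h0 hc hy hD
  obtain ⟨z₀, hz₀, hz₀y, hneg, hpos⟩ := hd.exists_threshold hz hzy hdz
  set Δ : ℝ := (x - y) / c with hΔ
  have hΔ0 : 0 < Δ := div_pos (by linarith) hc
  have hcΔ : c * Δ = x - y := by rw [hΔ]; field_simp
  have hG := Real.Gamma_pos_of_pos hα0
  have hw₀ : 0 < (y - z₀) / c := div_pos (by linarith) hc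
  set w₀ : ℝ := (y - z₀) / c with hw₀def
  have hcw₀ : c * w₀ = y - z₀ := by rw [hw₀def]; field_simp
  -- Up to the factor exp (-Δ), ρ is the ratio of the gamma density at w + Δ to that at w. It is
  -- antitone because α - 1 ≥ 0.
  set ρ : ℝ → ℝ := fun w => ((w + Δ) / w) ^ (α - 1) with hρ
  have hρanti : ∀ w w', 0 < w → w ≤ w' → ρ w' ≤ ρ w := by
    intro w w' hw hww'
    have hw' := hw.trans_le hww'
    refine Real.rpow_le_rpow (by positivity) ?_ (by linarith)
    rw [div_le_div_iff₀ hw' hw]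
    nlinarith
  set k : ℝ → ℝ := fun w => (w + Δ) ^ (α - 1) * Real.exp (-(w + Δ)) * d (y - c * w) with hk
  have hxk : ∀ w, (w + Δ) ^ (α - 1) * Real.exp (-(w + Δ)) * d (x - c * (w + Δ)) = k w := by
    intro w
    simp only [hk]
    rw [show x - c * (w + Δ) = y - c * w by linarith]
  have hshift : (fun w => (Ioi (0 : ℝ)).indicator
      (fun w => w ^ (α - 1) * Real.exp (-w) * d (x - c * w)) (w + Δ)) = (Ioi (-Δ)).indicator k := by
    ext w
    by_cases hw : -Δ < w
    · rw [indicator_of_mem (show w + Δ ∈ Ioi 0 by simp only [mem_Ioi]; linarith),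
        indicator_of_mem (show w ∈ Ioi (-Δ) from hw), ← hxk]
    · rw [indicator_of_notMem (show w + Δ ∉ Ioi 0 by simp only [mem_Ioi]; linarith),
        indicator_of_notMem (show w ∉ Ioi (-Δ) from hw)]
  have hint : IntegrableOn k (Ioi (-Δ)) := by
    have h1 := (integrable_gammaMeasure_iff hα0 _).1 (integrable_comp_sub_mul hα0 hdm hB x c)
    rw [← integrable_indicator_iff measurableSet_Ioi] at h1
    have h2 := h1.comp_add_right Δ
    rwa [hshift, integrable_indicator_iff measurableSet_Ioi] at h2
  have hval : ∫ w, d (x - c * w) ∂(gammaMeasure α 1)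
      = (Real.Gamma α)⁻¹ * ((∫ w in Ioc (-Δ) 0, k w) + ∫ w in Ioi 0, k w) := by
    rw [integral_gammaMeasure hα0, ← integral_indicator measurableSet_Ioi,
      ← integral_add_right_eq_self _ Δ, hshift, integral_indicator measurableSet_Ioi,
      ← Ioc_union_Ioi_eq_Ioi (show -Δ ≤ 0 by linarith), setIntegral_union (Ioc_disjoint_Ioi le_rfl)
      measurableSet_Ioi (hint.mono_set Ioc_subset_Ioi_self)
      (hint.mono_set (Ioi_subset_Ioi (by linarith)))]
  -- The extra piece gained in passing from y to x only sees d at points ≥ y > z₀, where d > 0. This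
  -- gives strictness.
  have hfirst : 0 < ∫ w in Ioc (-Δ) 0, k w := by
    have hkpos : ∀ w ∈ Ioc (-Δ) 0, 0 < k w := by
      intro w hw
      have h1 : 0 < w + Δ := by linarith [hw.1]
      have h2 : 0 < d (y - c * w) := hpos _ (by nlinarith [hw.2])
      simp only [hk]
      positivity
    rw [setIntegral_pos_iff_support_of_nonneg_ae
      ((ae_restrict_iff' measurableSet_Ioc).2 (ae_of_all _ fun w hw => (hkpos w hw).le))
      (hint.mono_set Ioc_subset_Ioi_self)]
    refine lt_of_lt_of_le ?_ (measure_mono fun w hw => ⟨(hkpos w hw).ne', hw⟩)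
    simp [hΔ0]
  have hDy := hD
  simp only at hDy
  rw [integral_gammaMeasure hα0] at hDy
  have hDy' := nonneg_of_mul_nonneg_right hDy (by positivity)
  have hsecond : ρ w₀ * Real.exp (-Δ) * ∫ w in Ioi 0, w ^ (α - 1) * Real.exp (-w) * d (y - c * w)
      ≤ ∫ w in Ioi 0, k w := by
    rw [← integral_const_mul]
    refine setIntegral_mono_on_ae
      (((integrable_gammaMeasure_iff hα0 _).1 (integrable_comp_sub_mul hα0 hdm hB y c)).const_mul _)
      (hint.mono_set (Ioi_subset_Ioi (by linarith))) measurableSet_Ioi ?_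
    -- Nothing is known about d at 0, so the null point where y - c * w = 0 is dropped.
    have hne : ∀ᵐ w : ℝ, w ≠ y / c := by simp [ae_iff]
    filter_upwards [hne] with w hw (hw0 : 0 < w)
    have hfac : (w + Δ) ^ (α - 1) = ρ w * w ^ (α - 1) := by
      simp only [hρ]
      rw [← Real.mul_rpow (by positivity) hw0.le]
      congr 1
      field_simp
    have hexp : Real.exp (-(w + Δ)) = Real.exp (-Δ) * Real.exp (-w) := by
      rw [← Real.exp_add]; ring_nf
    -- As w passes w₀, d (y - c * w) goes from positive to nonpositive while ρ decreases through ρ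
    -- w₀, so (ρ w - ρ w₀) and d never have opposite signs.
    have key : ρ w₀ * d (y - c * w) ≤ ρ w * d (y - c * w) := by
      have hz' : y - c * w ≠ 0 := fun e => hw (by field_simp; linarith)
      rcases lt_trichotomy (y - c * w) z₀ with h1 | h1 | h1
      · rcases lt_or_gt_of_ne hz' with h2 | h2
        · simp [h0 _ h2]
        · have : w₀ ≤ w := by
            by_contra! hlt
            nlinarith
          exact mul_le_mul_of_nonpos_right (hρanti _ _ hw₀ this) (hneg _ h2 h1).le
      · have : w = w₀ := by
          have : c * w = c * w₀ := by linarith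
          exact mul_left_cancel₀ hc.ne' this
        rw [this]
      · have : w ≤ w₀ := by
          by_contra! hlt
          nlinarith
        exact mul_le_mul_of_nonneg_right (hρanti _ _ hw0 this) (hpos _ h1).le
    have hE : 0 ≤ Real.exp (-Δ) * w ^ (α - 1) * Real.exp (-w) := by positivity
    calc ρ w₀ * Real.exp (-Δ) * (w ^ (α - 1) * Real.exp (-w) * d (y - c * w))
        = (Real.exp (-Δ) * w ^ (α - 1) * Real.exp (-w)) * (ρ w₀ * d (y - c * w)) := by ring
      _ ≤ (Real.exp (-Δ) * w ^ (α - 1) * Real.exp (-w)) * (ρ w * d (y - c * w)) :=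
          mul_le_mul_of_nonneg_left key hE
      _ = k w := by simp only [hk]; rw [hfac, hexp]; ring
  have hρ0 : 0 ≤ ρ w₀ * Real.exp (-Δ) := by
    have : 0 ≤ ρ w₀ := Real.rpow_nonneg (by positivity) _
    positivity
  simp only
  rw [hval]
  have := mul_nonneg hρ0 hDy'
  have : 0 < (Real.Gamma α)⁻¹ := by positivity
  exact mul_pos this (by linarith)

/-- A crossing of two weighted sums persists after appending the same weight to both. -/
lemma UpCrossing.cons (hα : 1 ≤ α) {l l' : List ℝ} (hl : ∀ c ∈ l, 0 ≤ c) (hl' : ∀ c ∈ l', 0 ≤ c)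
    (h : UpCrossing fun y => gammaSumCDF α l y - gammaSumCDF α l' y) {c : ℝ} (hc : 0 ≤ c) :
    UpCrossing fun y => gammaSumCDF α (c :: l) y - gammaSumCDF α (c :: l') y := by
  have hα0 : 0 < α := by linarith
  have := isProbabilityMeasure_gammaMeasure hα0 one_pos
  have heq : (fun y => gammaSumCDF α (c :: l) y - gammaSumCDF α (c :: l') y) = fun y =>
      ∫ w, (gammaSumCDF α l (y - c * w) - gammaSumCDF α l' (y - c * w)) ∂(gammaMeasure α 1) := by
    ext y
    rw [gammaSumCDF_cons hα0, gammaSumCDF_cons hα0,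
      integral_sub (integrable_gammaSumCDF_sub_mul hα0 l y c)
      (integrable_gammaSumCDF_sub_mul hα0 l' y c)]
  rw [heq]
  rcases hc.eq_or_lt with rfl | hc
  · simpa using h
  · refine UpCrossing.integral_comp_sub_mul hα (d := fun z => gammaSumCDF α l z - gammaSumCDF α l' z)
      ((measurable_gammaSumCDF hα0 l).sub (measurable_gammaSumCDF hα0 l')) (B := 1) (fun z => ?_)
      (fun z hz => ?_) h hc
    · have h1 := gammaSumCDF_nonneg (α := α) l z
      have h2 := gammaSumCDF_nonneg (α := α) l' z
      have h3 := gammaSumCDF_le_one hα0 l z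
      have h4 := gammaSumCDF_le_one hα0 l' z
      rw [abs_le]
      constructor <;> linarith
    · simp [gammaSumCDF_of_neg hα0 hl hz, gammaSumCDF_of_neg hα0 hl' hz]

lemma UpCrossing.append (hα : 1 ≤ α) {l l' : List ℝ} (hl : ∀ c ∈ l, 0 ≤ c)
    (hl' : ∀ c ∈ l', 0 ≤ c)
    (h : UpCrossing fun y => gammaSumCDF α l y - gammaSumCDF α l' y) {R : List ℝ}
    (hR : ∀ c ∈ R, 0 ≤ c) :
    UpCrossing fun y => gammaSumCDF α (R ++ l) y - gammaSumCDF α (R ++ l') y := by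
  induction R with
  | nil => exact h
  | cons c R ih =>
    have hR' : ∀ c ∈ R, 0 ≤ c := fun c' hc' => hR c' (by simp [hc'])
    refine UpCrossing.cons hα ?_ ?_ (ih hR') (hR c (by simp))
    · intro c' hc'
      rcases List.mem_append.1 hc' with h | h
      exacts [hR' _ h, hl _ h]
    · intro c' hc'
      rcases List.mem_append.1 hc' with h | h
      exacts [hR' _ h, hl' _ h]

end Convolution

/-! ### Spreading two weights -/

section Pair

variable {α : ℝ}

lemma gammaSumCDF_singleton_lt (hα : 0 < α) {a a' : ℝ} (ha : 0 ≤ a) (haa' : a < a') {y : ℝ}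
    (hy : 0 < y) : gammaSumCDF α [a'] y < gammaSumCDF α [a] y := by
  have := isProbabilityMeasure_gammaMeasure hα one_pos
  have ha' : 0 < a' := ha.trans_lt haa'
  have h1 := integrable_gammaSumCDF_sub_mul hα [] y a
  have h2 := integrable_gammaSumCDF_sub_mul hα [] y a'
  rw [← sub_pos, gammaSumCDF_cons hα, gammaSumCDF_cons hα, ← integral_sub h1 h2,
    integral_pos_iff_support_of_nonneg_ae (f := fun u => gammaSumCDF α [] (y - a * u)
      - gammaSumCDF α [] (y - a' * u)) ?_ (h1.sub h2)]
  · have hlt : y / a' < 2 * y / (a + a') := by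
      rw [div_lt_div_iff₀ ha' (by linarith)]
      nlinarith
    refine (gammaMeasure_Ioo_pos hα (by positivity) hlt).trans_le (measure_mono fun u hu => ?_)
    have h3 : y < u * a' := (div_lt_iff₀ ha').1 hu.1
    have h4 : u * (a + a') < 2 * y := (lt_div_iff₀ (by linarith)).1 hu.2
    have h5 : 0 < u := by
      by_contra! h
      nlinarith
    have h6 : 0 ≤ y - a * u := by nlinarith
    have h7 : ¬ 0 ≤ y - a' * u := by nlinarith
    simp only [Function.mem_support, gammaSumCDF_nil, h6, h7, if_true, if_false]
    norm_num
  · filter_upwards [ae_pos_gammaMeasure (α := α)] with u hu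
    exact sub_nonneg.2 (gammaSumCDF_mono hα [] (by nlinarith))

lemma upCrossing_singleton_lt (hα : 0 < α) {a a' : ℝ} (ha : 0 ≤ a) (haa' : a < a') :
    UpCrossing fun y => gammaSumCDF α [a] y - gammaSumCDF α [a'] y :=
  fun _ _ hy hyx _ => sub_pos.2 (gammaSumCDF_singleton_lt hα ha haa' (hy.trans hyx))

/-- The difference is negative on (0, ∞), so the premise of `UpCrossing` never holds. -/
lemma upCrossing_singleton_gt (hα : 0 < α) {b b' : ℝ} (hb' : 0 ≤ b') (hbb' : b' < b) :
    UpCrossing fun y => gammaSumCDF α [b] y - gammaSumCDF α [b'] y := by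
  intro y x hy _ h
  have := gammaSumCDF_singleton_lt hα hb' hbb' hy
  linarith

/-- Difference of the indicators of the events `a u + b v ≤ y` and `a' u + b' v ≤ y`. -/
noncomputable def halfPlaneDiff (a b a' b' y : ℝ) (p : ℝ × ℝ) : ℝ :=
  (if a * p.1 + b * p.2 ≤ y then 1 else 0) - (if a' * p.1 + b' * p.2 ≤ y then 1 else 0)

lemma measurable_halfPlaneDiff (a b a' b' y : ℝ) : Measurable (halfPlaneDiff a b a' b' y) := by
  unfold halfPlaneDiff
  refine Measurable.sub ?_ ?_ <;>
  exact Measurable.ite (measurableSet_le (by fun_prop) measurable_const) measurable_const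
    measurable_const

lemma abs_halfPlaneDiff_le (a b a' b' y : ℝ) (p : ℝ × ℝ) : |halfPlaneDiff a b a' b' y p| ≤ 1 := by
  unfold halfPlaneDiff
  split_ifs <;> simp

lemma gammaSumCDF_pair_sub (hα : 0 < α) (a b a' b' y : ℝ) :
    gammaSumCDF α [a, b] y - gammaSumCDF α [a', b'] y
      = ∫ u, ∫ v, halfPlaneDiff a b a' b' y (u, v) ∂(gammaMeasure α 1) ∂(gammaMeasure α 1) := by
  have := isProbabilityMeasure_gammaMeasure hα one_pos
  rw [gammaSumCDF_cons hα, gammaSumCDF_cons hα,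
    ← integral_sub (integrable_gammaSumCDF_sub_mul hα _ y a)
      (integrable_gammaSumCDF_sub_mul hα _ y a')]
  congr 1
  ext u
  rw [gammaSumCDF_cons hα, gammaSumCDF_cons hα,
    ← integral_sub (integrable_gammaSumCDF_sub_mul hα _ _ b)
      (integrable_gammaSumCDF_sub_mul hα _ _ b')]
  congr 1
  ext v
  simp only [gammaSumCDF_nil, halfPlaneDiff, le_sub_iff_add_le', add_zero]

lemma halfPlaneDiff_scale {y x : ℝ} (hy : 0 < y) (hx : 0 < x) (a b a' b' u v : ℝ) :
    halfPlaneDiff a b a' b' x (x / y * u, x / y * v) = halfPlaneDiff a b a' b' y (u, v) := by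
  have h : ∀ a b : ℝ, a * (x / y * u) + b * (x / y * v) ≤ x ↔ a * u + b * v ≤ y := by
    intro a b
    rw [show a * (x / y * u) + b * (x / y * v) = x * ((a * u + b * v) / y) by field_simp,
      mul_le_iff_le_one_right hx, div_le_one hy]
  simp only [halfPlaneDiff, h]

lemma ae_prod_pos (hα : 0 < α) :
    ∀ᵐ p ∂((gammaMeasure α 1).prod (gammaMeasure α 1)), 0 < p.1 ∧ 0 < p.2 := by
  have := isProbabilityMeasure_gammaMeasure hα one_pos
  exact (Measure.quasiMeasurePreserving_fst.ae ae_pos_gammaMeasure).and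
    (Measure.quasiMeasurePreserving_snd.ae ae_pos_gammaMeasure)

lemma integrable_halfPlaneDiff (hα : 0 < α) (a b a' b' y : ℝ) :
    Integrable (halfPlaneDiff a b a' b' y) ((gammaMeasure α 1).prod (gammaMeasure α 1)) := by
  have := isProbabilityMeasure_gammaMeasure hα one_pos
  exact Integrable.of_bound (C := 1) (measurable_halfPlaneDiff a b a' b' y).aestronglyMeasurable
    (ae_of_all _ fun w => abs_halfPlaneDiff_le a b a' b' y w)

lemma integrable_halfPlaneDiff_mul_exp (hα : 0 < α) (a b a' b' y : ℝ) {δ : ℝ} (hδ : 0 ≤ δ) :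
    Integrable (fun p : ℝ × ℝ => halfPlaneDiff a b a' b' y p * Real.exp (-(δ * (p.1 + p.2))))
      ((gammaMeasure α 1).prod (gammaMeasure α 1)) := by
  have := isProbabilityMeasure_gammaMeasure hα one_pos
  refine Integrable.of_bound (C := 1)
    ((measurable_halfPlaneDiff a b a' b' y).mul (by fun_prop)).aestronglyMeasurable ?_
  filter_upwards [ae_prod_pos hα] with p hp
  rw [norm_mul, Real.norm_eq_abs, Real.norm_eq_abs, Real.abs_exp]
  have h1 := abs_halfPlaneDiff_le a b a' b' y p
  have h2 : Real.exp (-(δ * (p.1 + p.2))) ≤ 1 := by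
    rw [Real.exp_le_one_iff]
    have := mul_nonneg hδ (add_pos hp.1 hp.2).le
    linarith
  exact mul_le_one₀ h1 (Real.exp_pos _).le h2

/-- Rescaling both variables by x / y carries the half planes at level x to those at level y; the
only trace of x is a positive factor and a tilt in u + v. -/
lemma integral_halfPlaneDiff_scale (hα : 0 < α) {y x : ℝ} (hy : 0 < y) (hx : 0 < x)
    (a b a' b' : ℝ) :
    ∫ u, ∫ v, halfPlaneDiff a b a' b' x (u, v) ∂(gammaMeasure α 1) ∂(gammaMeasure α 1)
      = (x / y) ^ α * (x / y) ^ α * ∫ u, ∫ v, halfPlaneDiff a b a' b' y (u, v)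
          * Real.exp (-((x / y - 1) * (u + v))) ∂(gammaMeasure α 1) ∂(gammaMeasure α 1) := by
  have hr : 0 < x / y := div_pos hx hy
  rw [integral_gammaMeasure_scale hα hr, mul_assoc]
  congr 1
  rw [← integral_const_mul]
  congr 1
  ext u
  rw [integral_gammaMeasure_scale hα hr, mul_assoc, ← integral_mul_const]
  congr 2
  ext v
  rw [halfPlaneDiff_scale hy hx, mul_assoc, ← Real.exp_add]
  ring_nf

/-- On the region where the half planes differ, the sum `u + v` lies on a definite side of its value
at the intersection of the bounding lines. -/
lemma halfPlaneDiff_le_mul_exp {a b a' b' y : ℝ} (haa' : a < a') (hbb' : b' < b) (hba : b ≤ a)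
    (hb' : 0 ≤ b') {δ : ℝ} (hδ : 0 < δ) (p : ℝ × ℝ) :
    halfPlaneDiff a b a' b' y p ≤ halfPlaneDiff a b a' b' y p *
        Real.exp (-(δ * (p.1 + p.2 - y * ((a' - b') - (a - b)) / (a' * b - a * b')))) ∧
      (y < a * p.1 + b * p.2 → a' * p.1 + b' * p.2 ≤ y →
        halfPlaneDiff a b a' b' y p < halfPlaneDiff a b a' b' y p *
          Real.exp (-(δ * (p.1 + p.2 - y * ((a' - b') - (a - b)) / (a' * b - a * b'))))) := by
  obtain ⟨u, v⟩ := p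
  have hdet : 0 < a' * b - a * b' := by nlinarith
  -- Writes u + v through the two linear forms. Since a' - b' > 0 and a - b ≥ 0, the bounds on the
  -- forms yield a one-sided bound on u + v; s is its value where both forms equal y.
  have hid : (u + v) * (a' * b - a * b')
      = (a' - b') * (a * u + b * v) - (a - b) * (a' * u + b' * v) := by ring
  set s := y * ((a' - b') - (a - b)) / (a' * b - a * b') with hs
  have hsid : s * (a' * b - a * b') = y * ((a' - b') - (a - b)) := by
    rw [hs, div_mul_cancel₀ _ hdet.ne']
  by_cases h1 : a * u + b * v ≤ y <;> by_cases h2 : a' * u + b' * v ≤ y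
  · simp [halfPlaneDiff, h1, h2]
  · push Not at h2
    have hle : u + v ≤ s := by
      refine le_of_mul_le_mul_right ?_ hdet
      rw [hid, hsid]
      nlinarith [mul_le_mul_of_nonneg_left h1 (show 0 ≤ a' - b' by linarith),
        mul_le_mul_of_nonneg_left h2.le (show 0 ≤ a - b by linarith)]
    have hexp : 1 ≤ Real.exp (-(δ * (u + v - s))) := by
      rw [Real.one_le_exp_iff]
      nlinarith
    simp only [halfPlaneDiff, h1, h2.not_ge, if_true, if_false]
    exact ⟨by linarith, fun h => absurd h1 h.not_ge⟩
  · push Not at h1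
    have hlt : s < u + v := by
      refine lt_of_mul_lt_mul_right ?_ hdet.le
      rw [hid, hsid]
      nlinarith [mul_lt_mul_of_pos_left h1 (show 0 < a' - b' by linarith),
        mul_le_mul_of_nonneg_left h2 (show 0 ≤ a - b by linarith)]
    have hexp : Real.exp (-(δ * (u + v - s))) < 1 := by
      rw [Real.exp_lt_one_iff]
      nlinarith [mul_pos hδ (sub_pos.2 hlt)]
    simp only [halfPlaneDiff, h1.not_ge, h2, if_true, if_false]
    exact ⟨by linarith, fun _ _ => by linarith⟩
  · exact ⟨by simp [halfPlaneDiff, h1, h2], fun _ h => absurd h h2⟩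

lemma gammaMeasure_prod_region_pos (hα : 0 < α) {a b a' b' y : ℝ} (haa' : a < a') (hbb' : b' < b)
    (hba : b ≤ a) (hb' : 0 ≤ b') (hy : 0 < y) :
    0 < (gammaMeasure α 1).prod (gammaMeasure α 1)
      {p : ℝ × ℝ | y < a * p.1 + b * p.2 ∧ a' * p.1 + b' * p.2 ≤ y} := by
  have := isProbabilityMeasure_gammaMeasure hα one_pos
  have hb : 0 < b := by linarith
  have ha' : 0 < a' := by linarith
  have hε : 0 < y * (1 - b' / b) / (a' + b') := by
    have : 0 < 1 - b' / b := by rw [sub_pos, div_lt_one hb]; exact hbb'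
    positivity
  -- A box of side ε with corner (0, y / b) lies in the region; ε puts its far corner exactly on the
  -- line a' u + b' v = y.
  set ε := y * (1 - b' / b) / (a' + b') with hεdef
  have hεid : (a' + b') * ε = y - b' * (y / b) := by rw [hεdef]; field_simp
  refine lt_of_lt_of_le ?_ (measure_mono
    (show Ioo 0 ε ×ˢ Ioo (y / b) (y / b + ε) ⊆ _ from fun p hp => ?_))
  · rw [Measure.prod_prod]
    exact ENNReal.mul_pos (gammaMeasure_Ioo_pos hα le_rfl hε).ne'
      (gammaMeasure_Ioo_pos hα (by positivity) (by linarith)).ne'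
  · obtain ⟨⟨h1, h2⟩, h3, h4⟩ := hp
    have h5 : y < p.2 * b := (div_lt_iff₀ hb).1 h3
    refine ⟨by nlinarith [mul_pos (hb.trans_le hba) h1], ?_⟩
    nlinarith [mul_le_mul_of_nonneg_left h2.le ha'.le, mul_le_mul_of_nonneg_left h4.le hb']

lemma upCrossing_pair_of_lt (hα : 0 < α) {a b a' b' : ℝ} (haa' : a < a') (hbb' : b' < b)
    (hba : b ≤ a) (hb' : 0 ≤ b') :
    UpCrossing fun y => gammaSumCDF α [a, b] y - gammaSumCDF α [a', b'] y := by
  intro y x hy hyx hD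
  have := isProbabilityMeasure_gammaMeasure hα one_pos
  have hx : 0 < x := hy.trans hyx
  have hδ : 0 < x / y - 1 := by rw [sub_pos, one_lt_div hy]; exact hyx
  simp only [gammaSumCDF_pair_sub hα] at hD ⊢
  rw [integral_halfPlaneDiff_scale hα hy hx]
  set δ := x / y - 1
  have hr : 0 < x / y := div_pos hx hy
  have hi1 := integrable_halfPlaneDiff hα a b a' b' y
  have hi2 := integrable_halfPlaneDiff_mul_exp hα a b a' b' y hδ.le
  rw [← integral_prod _ hi1] at hD
  rw [← integral_prod (fun p : ℝ × ℝ => halfPlaneDiff a b a' b' y p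
    * Real.exp (-(δ * (p.1 + p.2)))) hi2]
  set s := y * ((a' - b') - (a - b)) / (a' * b - a * b') with hs
  -- Centring the tilt at s costs only the positive constant exp (δ * s), which does not affect the
  -- sign.
  have hfac : (fun p : ℝ × ℝ => halfPlaneDiff a b a' b' y p * Real.exp (-(δ * (p.1 + p.2 - s))))
      = fun p => Real.exp (δ * s)
        * (halfPlaneDiff a b a' b' y p * Real.exp (-(δ * (p.1 + p.2)))) := by
    ext p
    rw [mul_left_comm, ← Real.exp_add]
    ring_nf
  have hi3 : Integrable (fun p : ℝ × ℝ => halfPlaneDiff a b a' b' y p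
      * Real.exp (-(δ * (p.1 + p.2 - s)))) ((gammaMeasure α 1).prod (gammaMeasure α 1)) := by
    rw [hfac]; exact hi2.const_mul _
  have hpt := halfPlaneDiff_le_mul_exp (y := y) haa' hbb' hba hb' hδ
  have hpos : 0 < ∫ p : ℝ × ℝ, (halfPlaneDiff a b a' b' y p * Real.exp (-(δ * (p.1 + p.2 - s)))
      - halfPlaneDiff a b a' b' y p) ∂((gammaMeasure α 1).prod (gammaMeasure α 1)) := by
    rw [integral_pos_iff_support_of_nonneg (fun p => sub_nonneg.2 (hpt p).1) (hi3.sub hi1)]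
    refine (gammaMeasure_prod_region_pos hα haa' hbb' hba hb' hy).trans_le
      (measure_mono fun p hp => ?_)
    exact (sub_pos.2 ((hpt p).2 hp.1 hp.2)).ne'
  rw [integral_sub hi3 hi1, hfac, integral_const_mul] at hpos
  have h1 : 0 < Real.exp (δ * s) * ∫ p : ℝ × ℝ, halfPlaneDiff a b a' b' y p
      * Real.exp (-(δ * (p.1 + p.2))) ∂((gammaMeasure α 1).prod (gammaMeasure α 1)) := by linarith
  exact mul_pos (by positivity) (pos_of_mul_pos_right h1 (Real.exp_pos _).le)

/-- Spreading two weights apart, without keeping their sum, moves the distribution function across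
at most one upward crossing. -/
lemma upCrossing_pair (hα : 1 ≤ α) {a b a' b' : ℝ} (haa' : a ≤ a') (hbb' : b' ≤ b) (hba : b ≤ a)
    (hb' : 0 ≤ b') (hne : a ≠ a' ∨ b ≠ b') {R : List ℝ} (hR : ∀ c ∈ R, 0 ≤ c) :
    UpCrossing fun y => gammaSumCDF α (R ++ [a, b]) y - gammaSumCDF α (R ++ [a', b']) y := by
  have hα0 : 0 < α := by linarith
  have hb : 0 ≤ b := hb'.trans hbb'
  have ha : 0 ≤ a := hb.trans hba
  have hnn : ∀ c d : ℝ, 0 ≤ c → 0 ≤ d → ∀ e ∈ [c, d], 0 ≤ e := by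
    intro c d hc hd e he
    simp only [List.mem_cons, List.not_mem_nil, or_false] at he
    rcases he with rfl | rfl <;> assumption
  refine UpCrossing.append hα (hnn _ _ ha hb) (hnn _ _ (ha.trans haa') hb') ?_ hR
  have hnn1 : ∀ c : ℝ, 0 ≤ c → ∀ e ∈ [c], 0 ≤ e := by simp
  rcases haa'.eq_or_lt with rfl | haa'
  · have hbb' : b' < b := lt_of_le_of_ne hbb' (by simpa [eq_comm] using hne)
    exact UpCrossing.cons hα (hnn1 _ hb) (hnn1 _ hb') (upCrossing_singleton_gt hα0 hb' hbb') ha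
  · rcases hbb'.eq_or_lt with rfl | hbb'
    · rw [gammaSumCDF_perm hα0 (List.Perm.swap b' a []), gammaSumCDF_perm hα0 (List.Perm.swap b' a' [])]
      exact UpCrossing.cons hα (hnn1 _ ha) (hnn1 _ (ha.trans haa'.le))
        (upCrossing_singleton_lt hα0 ha haa') hb
    · exact upCrossing_pair_of_lt hα0 haa' hbb' hba hb'

end Pair

/-! ### Continuity in the argument and in a weight -/

section Continuity

variable {α : ℝ}

lemma continuous_gammaSumCDF_cons (hα : 0 < α) {c : ℝ} (hc : 0 < c) (l : List ℝ) :
    Continuous (gammaSumCDF α (c :: l)) := by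
  have := isProbabilityMeasure_gammaMeasure hα one_pos
  rw [continuous_iff_continuousAt]
  intro y₀
  rw [show gammaSumCDF α (c :: l) = fun y => ∫ w, gammaSumCDF α l (y - c * w) ∂(gammaMeasure α 1)
    from funext (gammaSumCDF_cons hα c l)]
  refine continuousAt_of_dominated (bound := fun _ => 1)
    (Eventually.of_forall fun y => (integrable_gammaSumCDF_sub_mul hα l y c).aestronglyMeasurable)
    (Eventually.of_forall fun y => ae_of_all _ fun w => abs_gammaSumCDF_le_one hα l _)
    (integrable_const _) ?_
  -- A monotone function has countably many discontinuities, so for almost every w the integrand is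
  -- continuous at y₀.
  have hcount : ((fun w => y₀ - c * w) ⁻¹' {z | ¬ ContinuousAt (gammaSumCDF α l) z}).Countable :=
    (gammaSumCDF_mono hα l).countable_not_continuousAt.preimage fun u v huv => by
      have : c * u = c * v := by simpa using huv
      exact mul_left_cancel₀ hc.ne' this
  have hnull := gammaMeasure_absolutelyContinuous (α := α) (hcount.measure_zero volume)
  rw [← compl_mem_ae_iff] at hnull
  filter_upwards [hnull] with w hw
  have hw' : ContinuousAt (gammaSumCDF α l) (y₀ - c * w) := by simpa using hw
  exact ContinuousAt.comp (f := fun y => y - c * w) hw' (by fun_prop)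

lemma continuous_gammaSumCDF_of_mem (hα : 0 < α) {c : ℝ} (hc : 0 < c) {l : List ℝ} (hl : c ∈ l) :
    Continuous (gammaSumCDF α l) := by
  rw [gammaSumCDF_perm hα (List.perm_cons_erase hl)]
  exact continuous_gammaSumCDF_cons hα hc _

lemma continuous_gammaSumCDF_weight (hα : 0 < α) {c : ℝ} (hc : 0 < c) {l : List ℝ} (hl : c ∈ l)
    (y : ℝ) : Continuous fun z => gammaSumCDF α (z :: l) y := by
  have := isProbabilityMeasure_gammaMeasure hα one_pos
  have hcont := continuous_gammaSumCDF_of_mem hα hc hl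
  simp only [gammaSumCDF_cons hα]
  exact continuous_of_dominated (bound := fun _ => 1)
    (fun z => (integrable_gammaSumCDF_sub_mul hα l y z).aestronglyMeasurable)
    (fun z => ae_of_all _ fun w => abs_gammaSumCDF_le_one hα l _)
    (integrable_const _) (ae_of_all _ fun w => hcont.comp (by fun_prop))

/-- Lowering one weight from `b` to `b'` attains some value in any given window. -/
lemma exists_weight_mem_Icc (hα : 0 < α) {c : ℝ} (hc : 0 < c) {l : List ℝ} (hl : c ∈ l) {y p q : ℝ}
    {b b' : ℝ} (hb : b' ≤ b) (hpq : p ≤ q) (h1 : gammaSumCDF α (b :: l) y ≤ q)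
    (h2 : p ≤ gammaSumCDF α (b' :: l) y) :
    ∃ z ∈ Icc b' b, gammaSumCDF α (z :: l) y ∈ Icc p q := by
  by_cases h : gammaSumCDF α (b' :: l) y ≤ q
  · exact ⟨b', ⟨le_rfl, hb⟩, h2, h⟩
  · push Not at h
    obtain ⟨z, hz, hzq⟩ := intermediate_value_Icc' hb
      (continuous_gammaSumCDF_weight hα hc hl y).continuousOn ⟨h1, h.le⟩
    exact ⟨z, hz, by simp only at hzq; rw [hzq]; exact ⟨hpq, le_rfl⟩⟩

end Continuity

/-! ### Three weights through an intermediate triple -/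

section Triple

variable {α : ℝ}

lemma gammaSumCDF_pair_le_of_le {a b a' b' : ℝ} (hα : 1 ≤ α) (haa' : a ≤ a') (hbb' : b' ≤ b)
    (hba : b ≤ a) (hb' : 0 ≤ b') {R : List ℝ} (hR : ∀ c ∈ R, 0 ≤ c) {y x : ℝ} (hy : 0 < y)
    (hyx : y < x)
    (h : gammaSumCDF α (R ++ [a', b']) y ≤ gammaSumCDF α (R ++ [a, b]) y) :
    gammaSumCDF α (R ++ [a', b']) x ≤ gammaSumCDF α (R ++ [a, b]) x ∧
      (a ≠ a' ∨ b ≠ b' → gammaSumCDF α (R ++ [a', b']) x < gammaSumCDF α (R ++ [a, b]) x) := by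
  have hlt : a ≠ a' ∨ b ≠ b' →
      gammaSumCDF α (R ++ [a', b']) x < gammaSumCDF α (R ++ [a, b]) x := fun hne =>
    sub_pos.1 (upCrossing_pair hα haa' hbb' hba hb' hne hR hy hyx (sub_nonneg.2 h))
  refine ⟨?_, hlt⟩
  by_cases hne : a ≠ a' ∨ b ≠ b'
  · exact (hlt hne).le
  · push Not at hne
    rw [hne.1, hne.2]

lemma upCrossing_triple (hα : 1 ≤ α) {a b c a' b' c' : ℝ} (hba : b ≤ a) (hcb : c ≤ b)
    (hba' : b' ≤ a') (hcb' : c' ≤ b') (hc' : 0 ≤ c') (haa' : a ≤ a') (hcc' : c' ≤ c)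
    (hne : ¬ (a = a' ∧ b = b' ∧ c = c')) {R : List ℝ} (hR : ∀ d ∈ R, 0 ≤ d) :
    UpCrossing fun y => gammaSumCDF α ([a, b, c] ++ R) y - gammaSumCDF α ([a', b', c'] ++ R) y := by
  intro y x hy hyx hD
  have hα0 : 0 < α := by linarith
  have hc : 0 ≤ c := hc'.trans hcc'
  have hb : 0 ≤ b := hc.trans hcb
  have ha' : 0 ≤ a' := (hb.trans hba).trans haa'
  have hperm1 : ∀ p q r : ℝ, gammaSumCDF α ([p, q, r] ++ R) = gammaSumCDF α (q :: R ++ [p, r]) :=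
    fun p q r => gammaSumCDF_perm hα0 (List.perm_iff_count.2 fun e => by
      simp [List.count_cons, List.count_append]; omega)
  have hperm2 : ∀ p q r : ℝ, gammaSumCDF α ([p, q, r] ++ R) = gammaSumCDF α (p :: R ++ [q, r]) :=
    fun p q r => gammaSumCDF_perm hα0 (List.perm_iff_count.2 fun e => by
      simp [List.count_cons, List.count_append]; omega)
  have hperm3 : ∀ p q r : ℝ, gammaSumCDF α ([p, q, r] ++ R) = gammaSumCDF α (r :: R ++ [p, q]) :=
    fun p q r => gammaSumCDF_perm hα0 (List.perm_iff_count.2 fun e => by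
      simp [List.count_cons, List.count_append]; omega)
  have hswap2 : ∀ p q r : ℝ, gammaSumCDF α ([p, q, r] ++ R) = gammaSumCDF α (q :: p :: r :: R) :=
    fun p q r => gammaSumCDF_perm hα0 (List.Perm.swap q p _)
  have hswap3 : ∀ p q r : ℝ, gammaSumCDF α ([p, q, r] ++ R) = gammaSumCDF α (r :: p :: q :: R) :=
    fun p q r => gammaSumCDF_perm hα0 (List.perm_iff_count.2 fun e => by
      simp [List.count_cons]; omega)
  have hconsR : ∀ p : ℝ, 0 ≤ p → ∀ d ∈ p :: R, 0 ≤ d := by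
    intro p hp d hd
    rcases List.mem_cons.1 hd with rfl | hd
    exacts [hp, hR d hd]
  simp only [sub_nonneg, sub_pos] at hD ⊢
  -- Intermediate triple (a', b, z) with c' ≤ z ≤ c: first (a, c) spreads to (a', z), then (b, z) to
  -- (b', c'). Its value at y can be placed in the window because a ≤ a' and b ≤ b'.
  by_cases hbb' : b ≤ b'
  · have hapos : 0 < a' := by
      rcases ha'.eq_or_lt with h | h
      · exact absurd ⟨by linarith, by linarith, by linarith⟩ hne
      · exact h
    obtain ⟨z, hz, hz1, hz2⟩ := exists_weight_mem_Icc (l := a' :: b :: R) hα0 hapos (by simp) hcc' hD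
      (by
        rw [← hswap3, show [a', b, c] ++ R = a' :: ([b, c] ++ R) from rfl]
        exact gammaSumCDF_cons_anti hα0 haa' _ y)
      (by
        rw [← hswap3, hswap2, hswap2]
        exact gammaSumCDF_cons_anti hα0 hbb' _ y)
    rw [← hswap3] at hz1 hz2
    rw [hperm1, hperm1 a] at hz2
    rw [hperm2, hperm2 a'] at hz1
    obtain ⟨h1, h1'⟩ := gammaSumCDF_pair_le_of_le hα haa' hz.2 (hcb.trans hba) (hc'.trans hz.1)
      (hconsR b hb) hy hyx hz2
    obtain ⟨h2, h2'⟩ := gammaSumCDF_pair_le_of_le hα hbb' hz.1 (hz.2.trans hcb) hc'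
      (hconsR a' ha') hy hyx hz1
    rw [← hperm1, ← hperm1 a] at h1 h1'
    rw [← hperm2, ← hperm2 a'] at h2 h2'
    by_cases h : a ≠ a' ∨ c ≠ z
    · exact h2.trans_lt (h1' h)
    · refine lt_of_lt_of_le (h2' ?_) h1
      by_contra! h'
      push Not at h
      exact hne ⟨h.1, h'.1, h.2.trans h'.2⟩
  -- Intermediate triple (z, b, c') with a ≤ z ≤ a': first (a, c) spreads to (z, c'), then (z, b) to
  -- (a', b'). Here the endpoint bounds for the window also use the assumed inequality at y, and the
  -- second move is always strict.
  · push Not at hbb'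
    obtain ⟨z, hz, hz1, hz2⟩ := exists_weight_mem_Icc (l := b :: c' :: R) hα0
      ((hc'.trans hcb').trans_lt hbb') (by simp) haa' hD
      (by
        refine le_trans ?_ hD
        rw [show a' :: b :: c' :: R = [a', b, c'] ++ R from rfl, hswap2, hswap2]
        exact gammaSumCDF_cons_anti hα0 hbb'.le _ y)
      (by
        refine hD.trans ?_
        rw [show a :: b :: c' :: R = [a, b, c'] ++ R from rfl, hswap3, hswap3]
        exact gammaSumCDF_cons_anti hα0 hcc' _ y)
    rw [show z :: b :: c' :: R = [z, b, c'] ++ R from rfl] at hz1 hz2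
    rw [hperm1, hperm1 a] at hz2
    rw [hperm3, hperm3 z] at hz1
    obtain ⟨h1, h1'⟩ := gammaSumCDF_pair_le_of_le hα hz.1 hcc' (hcb.trans hba) hc'
      (hconsR b hb) hy hyx hz2
    obtain ⟨h2, h2'⟩ := gammaSumCDF_pair_le_of_le hα hz.2 hbb'.le (hba.trans hz.1) (hc'.trans hcb')
      (hconsR c' hc') hy hyx hz1
    rw [← hperm1, ← hperm1 a] at h1
    rw [← hperm3, ← hperm3 z] at h2'
    exact (h2' (Or.inr hbb'.ne')).trans_le h1

end Triple

/-! ### Equal means force a crossing -/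

section Mean

variable {α : ℝ}

lemma lintegral_ofReal_gammaMeasure_ne_top (hα : 0 < α) :
    ∫⁻ w, ENNReal.ofReal w ∂(gammaMeasure α 1) ≠ ⊤ := by
  have h : Integrable (fun w : ℝ => w) (gammaMeasure α 1) := by
    rw [integrable_gammaMeasure_iff hα]
    refine (Real.GammaIntegral_convergent (show 0 < α + 1 by linarith)).congr_fun
      (fun w (hw : 0 < w) => ?_) measurableSet_Ioi
    have : w ^ α = w ^ (α - 1) * w := by
      rw [← Real.rpow_add_one hw.ne']; ring_nf
    simp only [add_sub_cancel_right]
    rw [this]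
    ring
  exact h.lintegral_lt_top.ne

lemma ae_nonneg_gammaSumLaw (hα : 0 < α) {l : List ℝ} (hl : ∀ c ∈ l, 0 ≤ c) :
    ∀ᵐ z ∂(gammaSumLaw α l), 0 ≤ z := by
  have := isProbabilityMeasure_gammaSumLaw hα l
  have h : ∀ n : ℕ, ∀ᵐ z ∂(gammaSumLaw α l), -(1 / ((n : ℝ) + 1)) < z := by
    intro n
    have hn : (0 : ℝ) < 1 / ((n : ℝ) + 1) := Nat.one_div_pos_of_nat
    have h0 := gammaSumCDF_of_neg hα hl (show -(1 / ((n : ℝ) + 1)) < 0 by linarith)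
    rw [gammaSumCDF, measureReal_eq_zero_iff] at h0
    rw [ae_iff]
    convert h0 using 2
    ext z
    simp
  filter_upwards [ae_all_iff.2 h] with z hz
  by_contra! hneg
  obtain ⟨n, hn⟩ := exists_nat_one_div_lt (show 0 < -z by linarith)
  linarith [hz n]

lemma lintegral_ofReal_gammaSumLaw (hα : 0 < α) {l : List ℝ} (hl : ∀ c ∈ l, 0 ≤ c) :
    ∫⁻ z, ENNReal.ofReal z ∂(gammaSumLaw α l)
      = ENNReal.ofReal l.sum * ∫⁻ w, ENNReal.ofReal w ∂(gammaMeasure α 1) := by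
  have := isProbabilityMeasure_gammaMeasure hα one_pos
  induction l with
  | nil => simp [gammaSumLaw, lintegral_dirac' _ ENNReal.measurable_ofReal]
  | cons c l ih =>
    have hl' : ∀ c ∈ l, 0 ≤ c := fun c' hc' => hl c' (by simp [hc'])
    have hc : 0 ≤ c := hl c (by simp)
    have := isProbabilityMeasure_gammaSumLaw hα l
    rw [gammaSumLaw, Measure.lintegral_conv ENNReal.measurable_ofReal,
      lintegral_map (Measurable.lintegral_prod_right' (f := fun p : ℝ × ℝ =>
        ENNReal.ofReal (p.1 + p.2)) (by fun_prop)) (by fun_prop)]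
    have h1 : ∀ᵐ w ∂(gammaMeasure α 1), ∫⁻ z, ENNReal.ofReal (c * w + z) ∂(gammaSumLaw α l)
        = ENNReal.ofReal c * ENNReal.ofReal w + ∫⁻ z, ENNReal.ofReal z ∂(gammaSumLaw α l) := by
      filter_upwards [ae_pos_gammaMeasure (α := α)] with w hw
      rw [← ENNReal.ofReal_mul hc]
      have h2 : ∀ᵐ z ∂(gammaSumLaw α l),
          ENNReal.ofReal (c * w + z) = ENNReal.ofReal (c * w) + ENNReal.ofReal z := by
        filter_upwards [ae_nonneg_gammaSumLaw hα hl'] with z hz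
        exact ENNReal.ofReal_add (mul_nonneg hc hw.le) hz
      rw [lintegral_congr_ae h2, lintegral_add_left measurable_const]
      simp
    rw [lintegral_congr_ae h1, lintegral_add_right _ measurable_const, lintegral_const_mul _
      ENNReal.measurable_ofReal, ih hl', List.sum_cons,
      ENNReal.ofReal_add hc (List.sum_nonneg hl'), add_mul]
    simp

/-- Two weighted sums with equal means cannot be strictly stochastically ordered. -/
lemma exists_gammaSumCDF_le (hα : 0 < α) {l l' : List ℝ} (hl : ∀ c ∈ l, 0 ≤ c)
    (hl' : ∀ c ∈ l', 0 ≤ c) (hsum : l.sum = l'.sum) :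
    ∃ t, 0 < t ∧ gammaSumCDF α l' t ≤ gammaSumCDF α l t := by
  by_contra! h
  have := isProbabilityMeasure_gammaSumLaw hα l
  have := isProbabilityMeasure_gammaSumLaw hα l'
  -- The layer-cake formula: the integral of the tail is the mean, which depends on the weights only
  -- through their sum.
  have hid : ∀ {k : List ℝ}, (∀ c ∈ k, 0 ≤ c) →
      ∫⁻ t in Ioi 0, gammaSumLaw α k (Ioi t)
        = ENNReal.ofReal k.sum * ∫⁻ w, ENNReal.ofReal w ∂(gammaMeasure α 1) := by
    intro k hk
    rw [← lintegral_ofReal_gammaSumLaw hα hk,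
      lintegral_eq_lintegral_meas_lt _ (ae_nonneg_gammaSumLaw hα hk) aemeasurable_id']
    rfl
  have hlt : ∫⁻ t in Ioi 0, gammaSumLaw α l' (Ioi t) < ∫⁻ t in Ioi 0, gammaSumLaw α l (Ioi t) := by
    refine lintegral_strict_mono ?_ ?_ ?_ ?_
    · intro h0
      have := congrArg (fun μ => μ univ) h0
      simp at this
    · exact (show Antitone fun t => gammaSumLaw α l (Ioi t) from
        fun s t hst => measure_mono (Ioi_subset_Ioi hst)).measurable.aemeasurable
    · rw [hid hl']
      exact ENNReal.mul_ne_top ENNReal.ofReal_ne_top (lintegral_ofReal_gammaMeasure_ne_top hα)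
    · refine (ae_restrict_iff' measurableSet_Ioi).2 (ae_of_all _ fun t ht => ?_)
      have hlt := h t ht
      rw [← ENNReal.toReal_lt_toReal (measure_ne_top _ _) (measure_ne_top _ _), ← measureReal_def,
        ← measureReal_def, ← compl_Iic, probReal_compl_eq_one_sub measurableSet_Iic,
        probReal_compl_eq_one_sub measurableSet_Iic]
      simp only [gammaSumCDF] at hlt
      linarith
  rw [hid hl, hid hl', hsum] at hlt
  exact lt_irrefl _ hlt

lemma UpCrossing.changesSignOnceNegToPos (hα : 0 < α) {l l' : List ℝ} (hl : ∀ c ∈ l, 0 ≤ c)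
    (hl' : ∀ c ∈ l', 0 ≤ c) (hsum : l.sum = l'.sum)
    (h : UpCrossing fun y => gammaSumCDF α l y - gammaSumCDF α l' y) :
    ChangesSignOnceNegToPos fun y => gammaSumCDF α l y - gammaSumCDF α l' y := by
  obtain ⟨z, hz, hzle⟩ := exists_gammaSumCDF_le hα hl hl' hsum
  obtain ⟨z₀, hz₀, -, hneg, hpos⟩ :=
    h.exists_threshold (y := z + 1) hz (by linarith) (sub_nonneg.2 hzle)
  refine ⟨z₀, hz₀.lt_of_ne ?_, hneg, hpos⟩
  -- A threshold at 0 would make the difference positive on all of (0, ∞), contradicting equal means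
  -- with the roles exchanged.
  rintro rfl
  obtain ⟨t, ht, htle⟩ := exists_gammaSumCDF_le hα hl' hl hsum.symm
  have := hpos t ht
  linarith

end Mean

/-! ### Identification of the law of the weighted sum -/

section Law

lemma map_sum_eq_gammaSumLaw {Ω : Type*} [MeasurableSpace Ω] (P : Measure Ω)
    [IsProbabilityMeasure P] {ι : Type*} [DecidableEq ι] {α : ℝ} (hα : 0 < α)
    {X : ι → Ω → ℝ} (hindep : iIndepFun X P) (hlaw : ∀ i, HasLaw (X i) (gammaMeasure α 1) P)
    (θ : ι → ℝ) (s : Finset ι) :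
    P.map (fun ω => ∑ i ∈ s, θ i * X i ω) = gammaSumLaw α (s.toList.map θ) := by
  have hm : ∀ i, AEMeasurable (fun ω => θ i * X i ω) P := fun i =>
    (hlaw i).aemeasurable.const_mul _
  have hind : iIndepFun (fun i ω => θ i * X i ω) P :=
    hindep.comp (fun i x => θ i * x) fun i => by fun_prop
  induction s using Finset.induction_on with
  | empty => simp [gammaSumLaw]
  | insert i s hi ih =>
    rw [gammaSumLaw_perm hα ((Finset.toList_insert hi).map θ), List.map_cons, gammaSumLaw, ← ih,
      ← (hlaw i).map_eq, AEMeasurable.map_map_of_aemeasurable (by fun_prop) (hlaw i).aemeasurable]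
    have hfun : (∑ j ∈ s, fun ω => θ j * X j ω) = fun ω => ∑ j ∈ s, θ j * X j ω := by
      ext ω
      simp
    have h1 := (hind.indepFun_finsetSum_of_notMem₀ hm hi).symm
    rw [hfun] at h1
    have h2 := h1.map_add_eq_map_conv_map₀ (hm i) (Finset.aemeasurable_fun_sum _ fun j _ => hm j)
    convert h2 using 2
    · ext ω
      simp [Finset.sum_insert hi]
    · rfl

end Law

/-! ### Consequences of majorization -/

section Majorization

lemma antitone_decreasing {n : ℕ} (x : Fin n → ℝ) : Antitone (decreasing x) := fun _ _ h =>
  Tuple.monotone_sort x (Fin.rev_le_rev.2 h)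

lemma sum_comp_decreasing {n : ℕ} (x : Fin n → ℝ) (f : ℝ → ℝ) :
    ∑ j, f (decreasing x j) = ∑ i, f (x i) :=
  Equiv.sum_comp (Fin.revPerm.trans (Tuple.sort x)) fun i => f (x i)

/-- With k the number of components of η above t, the left side is the sum of the k largest minus k
t, where majorization applies. Unlike partial sums of sorted vectors, this form is additive over
indices, so components common to η and θ cancel. -/
lemma Majorized.sum_max_sub_le {n : ℕ} {η θ : Fin n → ℝ} (h : Majorized η θ) (t : ℝ) :
    ∑ i, max (η i - t) 0 ≤ ∑ i, max (θ i - t) 0 := by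
  classical
  rw [← sum_comp_decreasing η fun z => max (z - t) 0, ← sum_comp_decreasing θ fun z => max (z - t) 0]
  have hex : ∃ k, k = n ∨ ∃ hk : k < n, decreasing η ⟨k, hk⟩ ≤ t := ⟨n, Or.inl rfl⟩
  obtain ⟨k, hkn, hlt, hge⟩ : ∃ k, k ≤ n ∧ (∀ j : Fin n, j.val < k → t < decreasing η j) ∧
      ∀ j : Fin n, k ≤ j.val → decreasing η j ≤ t := by
    refine ⟨Nat.find hex, Nat.find_min' hex (Or.inl rfl), fun j hj => ?_, fun j hj => ?_⟩
    · have := Nat.find_min hex hj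
      push Not at this
      exact this.2 j.2
    · rcases Nat.find_spec hex with h1 | ⟨hk, h1⟩
      · exact absurd j.2 (by omega)
      · exact (antitone_decreasing η (show (⟨Nat.find hex, hk⟩ : Fin n) ≤ j from hj)).trans h1
  have hη : ∑ j, max (decreasing η j - t) 0
      = ∑ j : Fin n with j.val < k, (decreasing η j - t) := by
    rw [Finset.sum_filter]
    refine Finset.sum_congr rfl fun j _ => ?_
    split_ifs with hj
    · exact max_eq_left (sub_nonneg.2 (hlt j hj).le)
    · exact max_eq_right (sub_nonpos.2 (hge j (not_lt.1 hj)))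
  have hθ : ∑ j : Fin n with j.val < k, (decreasing θ j - t)
      ≤ ∑ j, max (decreasing θ j - t) 0 := by
    rw [Finset.sum_filter]
    refine Finset.sum_le_sum fun j _ => ?_
    split_ifs
    exacts [le_max_left _ _, le_max_right _ _]
  rw [hη]
  refine le_trans ?_ hθ
  rw [Finset.sum_sub_distrib, Finset.sum_sub_distrib]
  linarith [h.1 k hkn]

lemma exists_sorted_perm (p q r : ℝ) :
    ∃ a b c, b ≤ a ∧ c ≤ b ∧ [a, b, c].Perm [p, q, r] := by
  rcases le_total p q with h1 | h1 <;> rcases le_total q r with h2 | h2 <;>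
    rcases le_total p r with h3 | h3
  · exact ⟨r, q, p, h2, h1, by grind⟩
  · exact ⟨r, q, p, h2, h1, by grind⟩
  · exact ⟨q, r, p, h2, h3, by grind⟩
  · exact ⟨q, p, r, h1, h3, by grind⟩
  · exact ⟨r, p, q, h3, h1, by grind⟩
  · exact ⟨p, r, q, h3, h2, by grind⟩
  · exact ⟨p, q, r, h1, h2, by grind⟩
  · exact ⟨p, q, r, h1, h2, by grind⟩

/-- Equal multisets of values mean fibres of equal size; bijections between the fibres glue to a
permutation. -/
lemma exists_perm_of_map_perm {ι : Type*} [Fintype ι] {f g : ι → ℝ} {s : List ι}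
    (hs : (s : Multiset ι) = Finset.univ.val) (h : (s.map f).Perm (s.map g)) :
    ∃ σ : Equiv.Perm ι, g = f ∘ σ := by
  classical
  have hcount : ∀ c, Fintype.card {i // g i = c} = Fintype.card {i // f i = c} := by
    intro c
    have h1 : Multiset.map f Finset.univ.val = Multiset.map g Finset.univ.val := by
      rw [← hs, Multiset.map_coe, Multiset.map_coe, Multiset.coe_eq_coe]
      exact h
    have h2 := congrArg (Multiset.count c) h1
    rw [Multiset.count_map, Multiset.count_map] at h2
    rw [Fintype.card_subtype, Fintype.card_subtype]
    simp only [eq_comm (a := c)] at h2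
    exact h2.symm
  refine ⟨Equiv.ofFiberEquiv fun c => Fintype.equivOfCardEq (hcount c), ?_⟩
  ext i
  exact (Equiv.ofFiberEquiv_map _ i).symm

lemma sum_triple_of_perm {a b c p q r : ℝ} (h : [a, b, c].Perm [p, q, r]) (f : ℝ → ℝ) :
    f p + f q + f r = f a + f b + f c := by
  have := (h.map f).sum_eq
  simp only [List.map_cons, List.map_nil, List.sum_cons, List.sum_nil, add_zero] at this
  linarith

end Majorization

end GammaConvolution

/-! ### Reduction of the theorem to sorted triples -/

open GammaConvolution in
theorem corollary1 {Ω : Type*} [MeasurableSpace Ω] (P : Measure Ω) [IsProbabilityMeasure P]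
    (n : ℕ) (hn : 3 ≤ n) (α : ℝ) (hα : 1 ≤ α)
    (X : Fin n → Ω → ℝ) (hindep : iIndepFun X P)
    (hlaw : ∀ i, HasLaw (X i) (gammaMeasure α 1) P)
    (η θ : Fin n → ℝ) (hη : ∀ i, 0 ≤ η i) (hθ : ∀ i, 0 ≤ θ i)
    (hmaj : GammaConvolution.Majorized η θ)
    (hperm : ¬ ∃ σ : Equiv.Perm (Fin n), θ = η ∘ σ)
    (hdiff : {i | η i ≠ θ i}.ncard ≤ 3) :
    GammaConvolution.ChangesSignOnceNegToPos
      (fun x => GammaConvolution.weightedCDF P X η x - GammaConvolution.weightedCDF P X θ x) := by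
  classical
  have hα0 : 0 < α := by linarith
  obtain ⟨I, hI, hIcard⟩ : ∃ I : Finset (Fin n), (∀ i ∉ I, η i = θ i) ∧ I.card = 3 := by
    have hcard : (Finset.univ.filter fun i => η i ≠ θ i).card ≤ 3 := by
      rw [← Set.ncard_coe_finset]
      simpa using hdiff
    -- The differing indices may be fewer than three; they are padded to exactly three, which 3 ≤ n
    -- permits.
    obtain ⟨I, hsub, -, hIc⟩ := Finset.exists_subsuperset_card_eq
      (Finset.subset_univ (Finset.univ.filter fun i => η i ≠ θ i)) hcard (by simpa using hn)
    refine ⟨I, fun i hi => ?_, hIc⟩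
    by_contra hne
    exact hi (hsub (by simpa using hne))
  obtain ⟨i, j, k, hij, hik, hjk, rfl⟩ := Finset.card_eq_three.1 hIcard
  set rest : List (Fin n) := (Finset.univ \ {i, j, k}).toList with hrest
  set R : List ℝ := rest.map η with hR
  have hRθ : rest.map θ = R := by
    refine List.map_congr_left fun m hm => (hI m ?_).symm
    rw [hrest, Finset.mem_toList, Finset.mem_sdiff] at hm
    exact hm.2
  have hR0 : ∀ c ∈ R, 0 ≤ c := by
    intro c hc
    obtain ⟨m, -, rfl⟩ := List.mem_map.1 hc
    exact hη m
  have huniv : (([i, j, k] ++ rest : List (Fin n)) : Multiset (Fin n)) = Finset.univ.val := by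
    have h1 : (Finset.univ : Finset (Fin n)).val
        = ({i, j, k} : Finset (Fin n)).val + (Finset.univ \ {i, j, k} : Finset (Fin n)).val := by
      rw [← Finset.disjUnion_val _ _ Finset.disjoint_sdiff, Finset.disjUnion_eq_union,
        Finset.union_sdiff_of_subset (Finset.subset_univ _)]
    rw [h1, ← Multiset.coe_add, hrest, Finset.coe_toList]
    congr 1
    rw [Finset.insert_val_of_notMem (by simp [hij, hik]), Finset.insert_val_of_notMem
      (by simp [hjk])]
    rfl
  obtain ⟨a, b, c, hba, hcb, hηp⟩ := exists_sorted_perm (η i) (η j) (η k)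
  obtain ⟨a', b', c', hba', hcb', hθp⟩ := exists_sorted_perm (θ i) (θ j) (θ k)
  have hsplit : ∀ f : Fin n → ℝ, ∑ m, f m = f i + f j + f k + (rest.map f).sum := by
    intro f
    rw [Finset.sum, ← huniv, Multiset.map_coe, Multiset.sum_coe]
    simp [add_assoc]
  have hcdf : ∀ (ζ : Fin n → ℝ) (p q r : ℝ), [p, q, r].Perm [ζ i, ζ j, ζ k] → rest.map ζ = R →
      weightedCDF P X ζ = gammaSumCDF α ([p, q, r] ++ R) := by
    intro ζ p q r hp hζ
    ext x
    have hpr := isProbabilityMeasure_gammaSumLaw hα0 ([p, q, r] ++ R)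
    have h1 : P.map (fun ω => ∑ i, ζ i * X i ω) = gammaSumLaw α ([p, q, r] ++ R) := by
      rw [map_sum_eq_gammaSumLaw P hα0 hindep hlaw ζ]
      refine gammaSumLaw_perm hα0 ?_
      have h2 : (Finset.univ : Finset (Fin n)).toList.Perm ([i, j, k] ++ rest) := by
        rw [← Multiset.coe_eq_coe, huniv, Finset.coe_toList]
      refine (h2.map ζ).trans ?_
      rw [List.map_append, hζ]
      exact (hp.symm).append_right R
    rw [weightedCDF, h1, cdf_eq_real, gammaSumCDF]
  have hmax : ∀ t, max (a - t) 0 + max (b - t) 0 + max (c - t) 0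
      ≤ max (a' - t) 0 + max (b' - t) 0 + max (c' - t) 0 := by
    intro t
    have h1 := hmaj.sum_max_sub_le t
    rw [hsplit, hsplit] at h1
    have h2 : rest.map (fun m => max (η m - t) 0) = rest.map (fun m => max (θ m - t) 0) := by
      have h3 := congrArg (List.map fun z => max (z - t) 0) (hR.symm.trans hRθ.symm)
      simpa using h3
    rw [h2, sum_triple_of_perm hηp (fun z => max (z - t) 0),
      sum_triple_of_perm hθp (fun z => max (z - t) 0)] at h1
    linarith
  have hsum : a + b + c = a' + b' + c' := by
    have h1 := hmaj.2
    rw [hsplit, hsplit, hRθ, sum_triple_of_perm hηp (fun z => z),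
      sum_triple_of_perm hθp (fun z => z)] at h1
    linarith
  -- At t = a' the right side vanishes, which bounds the largest weight; t = c' below, combined with
  -- equal sums, bounds the smallest.
  have haa' : a ≤ a' := by
    have h1 := hmax a'
    rw [max_eq_right (show a' - a' ≤ 0 by linarith), max_eq_right (show b' - a' ≤ 0 by linarith),
      max_eq_right (show c' - a' ≤ 0 by linarith)] at h1
    linarith [le_max_left (a - a') 0, le_max_right (b - a') 0, le_max_right (c - a') 0]
  have hcc' : c' ≤ c := by
    have h1 := hmax c'
    rw [max_eq_left (show 0 ≤ a' - c' by linarith), max_eq_left (show 0 ≤ b' - c' by linarith),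
      max_eq_left (show 0 ≤ c' - c' by linarith)] at h1
    linarith [le_max_left (a - c') 0, le_max_left (b - c') 0, le_max_right (c - c') 0]
  have hmem0 : ∀ {ζ : Fin n → ℝ} {p q r : ℝ}, (∀ m, 0 ≤ ζ m) → [p, q, r].Perm [ζ i, ζ j, ζ k] →
      ∀ d ∈ [p, q, r] ++ R, 0 ≤ d := by
    intro ζ p q r hζ hp d hd
    rcases List.mem_append.1 hd with h | h
    · have h1 := hp.mem_iff.1 h
      simp only [List.mem_cons, List.not_mem_nil, or_false] at h1
      rcases h1 with rfl | rfl | rfl <;> exact hζ _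
    · exact hR0 d h
  have hne : ¬ (a = a' ∧ b = b' ∧ c = c') := by
    rintro ⟨rfl, rfl, rfl⟩
    refine hperm (exists_perm_of_map_perm huniv ?_)
    rw [List.map_append, List.map_append, hRθ]
    exact (hηp.symm.trans hθp).append_right R
  rw [hcdf η a b c hηp rfl, hcdf θ a' b' c' hθp hRθ]
  exact (upCrossing_triple hα hba hcb hba' hcb' (hmem0 hθ hθp c' (by simp)) haa' hcc' hne
    hR0).changesSignOnceNegToPos hα0 (hmem0 hη hηp) (hmem0 hθ hθp)
      (by simp only [List.sum_append, List.sum_cons, List.sum_nil]; linarith)
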